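/- \textbf{Conventions.} All graphs are finite directed graphs without parallel edges (loops are permitted); $N^+(v)$ and $N^-(v)$ denote the sets of out- and in-neighbors of $v$. A \emph{flow graph} is such a graph $G$ with a distinguished vertex $s(G)$ (its source) from which every vertex is reachable. Flow graphs $G,G'$ are isomorphic, $G\cong G'$, if there is a bijection $V(G)\to V(G')$ preserving edges and non-edges and mapping $s(G)$ to $s(G')$. An edge $vw$ of $G$ is a \emph{cycle edge} if, in some depth-first search of $G$ starting from $s(G)$, $v$ is inserted in the stack after $w$ and before the removal of $w$ (if $G$ is reducible, this does not depend on the search). The \emph{non-trivial statement graphs} are the following graphs, with source $v$ and sink $t$: \emph{sequence}, with the edge $vt$; \emph{if}, with edges $vw,vt,wt$; \emph{if-then-else}, with edges $vw_1,vw_2,w_1t,w_2t$; \emph{$p$-case}, $p\ge 3$, with edges $vw_i,w_it$ ($1\le i\le p$); \emph{while}, with edges $vw,wv,vt$; \emph{repeat}, with edges $vw,wv,wt$ (vertices with different names being distinct). A \emph{non-trivial prime} of a flow graph $G$ is an induced subgraph $H$ of $G$, with source $s(H)$ and sink $t(H)$, which is isomorphic to a non-trivial statement graph, with $s(H)$ and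 $t(H)$ corresponding to its source and its sink, and which is closed, that is: \begin{itemize} \item $N^-(v)\subseteq V(H)$ for every $v\in V(H)\setminus\{s(H)\}$; \item $N^+(v)\subseteq V(H)$ for every $v\in V(H)\setminus\{t(H)\}$; \item if $v\,s(H)$ is a cycle edge of $G$, then $v\in N^+(s(H))$; \item $s(G)\notin V(H)\setminus\{s(H)\}$. \end{itemize} The \emph{contraction} $G\downarrow H$ is the flow graph obtained from $G$ by identifying all vertices of $H$ with $s(H)$ and then removing all parallel edges and loops; its source is the image of $s(G)$. A \emph{contractile sequence} of $G$ is a sequence of flow graphs $G_0,\dots,G_k$ ($k\ge 0$) such that $G\cong G_0$ and, for every $i<k$, $G_{i+1}\cong G_i\downarrow H_i$ for some non-trivial prime $H_i$ of $G_i$. It is \emph{maximal} if $G_k$ has no non-trivial prime. \textbf{Theorem.} Let $G$ be an arbitrary flow graph, and let $G_0,\dots,G_k$ and $G'_0,\dots,G'_{k'}$ be two maximal contractile sequences of $G$. Then $G_k\cong G'_{k'}$ and $k=k'$. -/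

import Mathlib

universe u

/-- A finite directed graph without parallel edges, with a distinguished vertex `source` that
reaches every vertex. -/
structure FlowGraph where
  V : Type u
  [finite : Finite V]
  graph : Digraph V
  source : V
  source_reaches : ∀ v, Relation.ReflTransGen graph.Adj source v

namespace FlowGraph

/-- Isomorphism of flow graphs: a bijection of the vertices that preserves edges and non-edges and
carries the distinguished source to the distinguished source. -/
def Isomorphic (G G' : FlowGraph.{u}) : Prop :=
  ∃ f : G.V ≃ G'.V,
    (∀ v w, G.graph.Adj v w ↔ G'.graph.Adj (f v) (f w)) ∧ f G.source = G'.source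

/-- `G.DFSState stack visited`: in some depth-first search of `G` starting from its source there is
a moment at which `stack` is the stack (top first) and `visited` is the set of the vertices that
have been inserted so far. The top is removed once all its out-neighbors have been inserted. -/
inductive DFSState (G : FlowGraph.{u}) : List G.V → Set G.V → Prop
  | start : DFSState G [G.source] {G.source}
  | push {v w : G.V} {stack : List G.V} {visited : Set G.V} :
      DFSState G (v :: stack) visited → G.graph.Adj v w → w ∉ visited →
        DFSState G (w :: v :: stack) (insert w visited)
  | pop {v : G.V} {stack : List G.V} {visited : Set G.V} :
      DFSState G (v :: stack) visited → (∀ w, G.graph.Adj v w → w ∈ visited) →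
        DFSState G stack visited

/-- The edge `vw` is a cycle edge: in some depth-first search starting from the source, `v` is
inserted in the stack after `w` and before the removal of `w`. -/
def IsCycleEdge (G : FlowGraph.{u}) (v w : G.V) : Prop :=
  G.graph.Adj v w ∧ ∃ stack visited, G.DFSState (v :: stack) visited ∧ w ∈ stack

end FlowGraph

/-- The statement graphs. -/
inductive StatementGraph
  | trivial
  | sequence
  | ifThen
  | ifThenElse
  | pCase (p : ℕ) (hp : 3 ≤ p)
  | whileLoop
  | repeatLoop

namespace StatementGraph

/-- Number of vertices minus one. -/
def last : StatementGraph → ℕ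
  | trivial => 0
  | sequence => 1
  | ifThen => 2
  | ifThenElse => 3
  | pCase p _ => p + 1
  | whileLoop => 2
  | repeatLoop => 2

/-- The vertices are `0, …, last`. -/
abbrev Vertex (K : StatementGraph) : Type := Fin (K.last + 1)

/-- The source is the vertex `0`. -/
def source (K : StatementGraph) : K.Vertex := 0

/-- The sink is the vertex `last`. -/
def sink (K : StatementGraph) : K.Vertex := Fin.last K.last

/-- The edges, in terms of the numbers of the vertices. -/
def Edge : StatementGraph → ℕ → ℕ → Prop
  | trivial, _, _ => False
  | sequence, a, b => a = 0 ∧ b = 1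
  | ifThen, a, b => (a = 0 ∧ b = 1) ∨ (a = 0 ∧ b = 2) ∨ (a = 1 ∧ b = 2)
  | ifThenElse, a, b =>
      (a = 0 ∧ b = 1) ∨ (a = 0 ∧ b = 2) ∨ (a = 1 ∧ b = 3) ∨ (a = 2 ∧ b = 3)
  | pCase p _, a, b => (a = 0 ∧ 1 ≤ b ∧ b ≤ p) ∨ (1 ≤ a ∧ a ≤ p ∧ b = p + 1)
  | whileLoop, a, b => (a = 0 ∧ b = 1) ∨ (a = 1 ∧ b = 0) ∨ (a = 0 ∧ b = 2)
  | repeatLoop, a, b => (a = 0 ∧ b = 1) ∨ (a = 1 ∧ b = 0) ∨ (a = 1 ∧ b = 2)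

/-- The statement graph as a digraph. -/
def graph (K : StatementGraph) : Digraph K.Vertex where
  Adj a b := K.Edge a b

end StatementGraph

namespace FlowGraph

/-- The subgraph of `G` induced by `H`, with source `s` and sink `t`, is closed. The last clause
says that the flow of control can enter `H` only at `s`: it does not start at another vertex
of `H`. -/
def IsClosed (G : FlowGraph.{u}) (H : Set G.V) (s t : G.V) : Prop :=
  (∀ v ∈ H, v ≠ s → ∀ u, G.graph.Adj u v → u ∈ H) ∧
  (∀ v ∈ H, v ≠ t → ∀ u, G.graph.Adj v u → u ∈ H) ∧
  (∀ v, G.IsCycleEdge v s → G.graph.Adj s v) ∧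
  (G.source ∈ H → G.source = s)

/-- The subgraph of `G` induced by the vertex set `H` is a non-trivial prime subgraph with
source `s` and sink `t`: it is isomorphic to a non-trivial statement graph, where `s` and `t`
correspond to the source and the sink, and it is closed. -/
def IsPrime (G : FlowGraph.{u}) (H : Set G.V) (s t : G.V) : Prop :=
  (∃ K : StatementGraph, K ≠ StatementGraph.trivial ∧ ∃ e : K.Vertex ≃ H,
    (∀ a b, K.graph.Adj a b ↔ G.graph.Adj (e a) (e b)) ∧
      (e K.source : G.V) = s ∧ (e K.sink : G.V) = t) ∧
  G.IsClosed H s t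

/-- The image of a vertex under the contraction of `H` into `s`. The vertices of the contracted
graph are `s` and the vertices outside `H`. -/
noncomputable def image (G : FlowGraph.{u}) (H : Set G.V) (s v : G.V) : {v : G.V // v = s ∨ v ∉ H} :=
  open Classical in if hv : v ∈ H then ⟨s, Or.inl rfl⟩ else ⟨v, Or.inr hv⟩

theorem image_surjective (G : FlowGraph.{u}) (H : Set G.V) (s : G.V) :
    Function.Surjective (G.image H s) := by
  rintro ⟨v, hv⟩
  refine ⟨v, ?_⟩
  unfold image
  split_ifs with h
  · rcases hv with rfl | hv
    · rfl
    · exact absurd h hv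
  · rfl

/-- The contraction of `H` into `s`: the vertices of `H` are identified with `s`, then parallel
edges and loops are removed. The distinguished source is the image of that of `G`. -/
noncomputable def contract (G : FlowGraph.{u}) (H : Set G.V) (s : G.V) : FlowGraph.{u} where
  V := {v : G.V // v = s ∨ v ∉ H}
  finite := by
    have := G.finite
    infer_instance
  graph :=
    { Adj := fun x y => x ≠ y ∧
        ∃ v w, G.image H s v = x ∧ G.image H s w = y ∧ G.graph.Adj v w }
  source := G.image H s G.source
  source_reaches := by
    intro x
    obtain ⟨v, rfl⟩ := G.image_surjective H s x
    induction G.source_reaches v with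
    | refl => exact Relation.ReflTransGen.refl
    | @tail b c _ hbc ih =>
      by_cases h : G.image H s b = G.image H s c
      · rw [← h]
        exact ih
      · exact ih.tail ⟨h, b, c, rfl, rfl, hbc⟩

/-- `S 0, …, S k` is a contractile sequence of `G`. -/
def IsContractileSequence (G : FlowGraph.{u}) (k : ℕ) (S : Fin (k + 1) → FlowGraph.{u}) : Prop :=
  G.Isomorphic (S 0) ∧
  ∀ i : Fin k, ∃ (H : Set (S i.castSucc).V) (s t : (S i.castSucc).V),
    (S i.castSucc).IsPrime H s t ∧ (S i.succ).Isomorphic ((S i.castSucc).contract H s)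

/-- The sequence `S 0, …, S k` is maximal: its last graph has no non-trivial prime subgraph. -/
def IsMaximalSequence (k : ℕ) (S : Fin (k + 1) → FlowGraph.{u}) : Prop :=
  ¬ ∃ (H : Set (S (Fin.last k)).V) (s t : (S (Fin.last k)).V), (S (Fin.last k)).IsPrime H s t

end FlowGraph

/-! Contraction of primes has a strict diamond property: two contractions of the same graph either
give isomorphic results or can be joined by exactly one further contraction on each side
(`Step.diamond`). Hence any first step out of G shortens a reduction to an irreducible graph by
exactly one (`Reduces.descend`), so both the end and the length are unique.

The diamond rests on how two primes H, K meet. The source of a closed subgraph dominates it, so two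
sources lying in each other's subgraph coincide. Primes with the same source are equal; otherwise
they are disjoint, or the sink of one is the source of the other and they share nothing else
(`IsPrime.disjoint_or`). In each case K stays prime when H is contracted (`IsPrime.image_of_ne`),
and contracting both, in either order, is the same quotient. The delicate condition is the one on
cycle edges: depth-first stacks are exactly the simple paths from the source, and these lift along
contractions. -/

namespace FlowGraph

variable {G G' : FlowGraph.{u}} {H K : Set G.V} {s t s' t' : G.V} {q : G.V → G'.V}

/-! ### Simple paths and cycle edges -/

/-- Simple paths from the source, listed from their last vertex back to the source. -/
inductive SimplePath (G : FlowGraph.{u}) : List G.V → Prop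
  | start : SimplePath G [G.source]
  | push {v w : G.V} {l : List G.V} :
      SimplePath G (v :: l) → G.graph.Adj v w → w ∉ v :: l → SimplePath G (w :: v :: l)

/-- A search that follows the path and never pops has visited exactly its stack. -/
theorem SimplePath.dfsState {l : List G.V} (h : G.SimplePath l) : G.DFSState l {x | x ∈ l} := by
  induction h with
  | start => simpa using DFSState.start (G := G)
  | @push v w l _ hvw hw ih =>
    have : {x | x ∈ w :: v :: l} = insert w {x | x ∈ v :: l} := by
      ext x
      simp
    rw [this]
    exact ih.push hvw hw

theorem DFSState.simplePath {l : List G.V} {visited : Set G.V} (h : G.DFSState l visited) :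
    (l = [] ∨ G.SimplePath l) ∧ ∀ x ∈ l, x ∈ visited := by
  induction h with
  | start => exact ⟨Or.inr .start, by simp⟩
  | push _ hvw hw ih =>
    obtain ⟨h | h, ih⟩ := ih
    · simp at h
    refine ⟨Or.inr (h.push hvw fun hmem => hw (ih _ hmem)), fun x hx => ?_⟩
    rcases List.mem_cons.1 hx with rfl | hx
    · exact Set.mem_insert _ _
    · exact Set.mem_insert_of_mem _ (ih x hx)
  | pop _ _ ih =>
    obtain ⟨h | h, ih⟩ := ih
    · simp at h
    refine ⟨?_, fun x hx => ih x (List.mem_cons_of_mem _ hx)⟩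
    cases h with
    | start => exact Or.inl rfl
    | push h _ _ => exact Or.inr h

theorem isCycleEdge_iff {v w : G.V} :
    G.IsCycleEdge v w ↔ G.graph.Adj v w ∧ ∃ l, G.SimplePath (v :: l) ∧ w ∈ l := by
  refine and_congr_right fun _ => ⟨?_, ?_⟩
  · rintro ⟨l, visited, h, hw⟩
    exact ⟨l, h.simplePath.1.resolve_left (by simp), hw⟩
  · rintro ⟨l, h, hw⟩
    exact ⟨l, _, h.dfsState, hw⟩

theorem SimplePath.exists_of_mem {l : List G.V} (h : G.SimplePath l) {x : G.V} (hx : x ∈ l) :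
    ∃ l', G.SimplePath (x :: l') := by
  induction h with
  | start => exact ⟨[], by simpa [List.mem_singleton.1 hx] using SimplePath.start (G := G)⟩
  | push h hvw hw ih =>
    rcases List.mem_cons.1 hx with rfl | hx
    · exact ⟨_, h.push hvw hw⟩
    · exact ih hx

theorem exists_simplePath (G : FlowGraph.{u}) (v : G.V) : ∃ l, G.SimplePath (v :: l) := by
  induction G.source_reaches v with
  | refl => exact ⟨[], .start⟩
  | @tail b c _ hbc ih =>
    obtain ⟨l, hl⟩ := ih
    by_cases hc : c ∈ b :: l
    · exact hl.exists_of_mem hc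
    · exact ⟨_, hl.push hbc hc⟩

/-- The source of a closed subgraph dominates its vertices. -/
theorem SimplePath.source_mem {l : List G.V} (h : G.SimplePath l) (hH : G.IsClosed H s t)
    {x : G.V} (hx : x ∈ l) (hxH : x ∈ H) : s ∈ l := by
  induction h generalizing x with
  | start =>
    rw [List.mem_singleton.1 hx] at hxH
    simp [hH.2.2.2 hxH]
  | @push v w l h hvw hw ih =>
    rcases List.mem_cons.1 hx with rfl | hx
    · by_cases hs : x = s
      · simp [hs]
      · exact List.mem_cons_of_mem _ (ih List.mem_cons_self (hH.1 x hxH hs v hvw))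
    · exact List.mem_cons_of_mem _ (ih hx hxH)

/-- If s ≠ s', each would dominate the other and have to occur first on every simple path, so
neither could occur on any; but s is reachable. -/
theorem IsClosed.source_eq_of_mem (hH : G.IsClosed H s t) (hK : G.IsClosed K s' t')
    (hs : s ∈ K) (hs' : s' ∈ H) : s = s' := by
  by_contra hne
  obtain ⟨l, hl⟩ := G.exists_simplePath s
  have key : ∀ l, G.SimplePath l → s ∉ l ∧ s' ∉ l := by
    intro l hl
    induction hl with
    | start =>
      simp only [List.mem_singleton]
      constructor
      · rintro rfl
        exact hne (hK.2.2.2 hs)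
      · rintro rfl
        exact hne (hH.2.2.2 hs').symm
    | @push v w l h hvw hw ih =>
      constructor
      · intro hmem
        rcases List.mem_cons.1 hmem with rfl | hmem
        · exact ih.2 (h.source_mem hK List.mem_cons_self (hK.1 _ hs hne v hvw))
        · exact ih.1 hmem
      · intro hmem
        rcases List.mem_cons.1 hmem with rfl | hmem
        · exact ih.1 (h.source_mem hH List.mem_cons_self (hH.1 _ hs' (Ne.symm hne) v hvw))
        · exact ih.2 hmem
  exact (key _ hl).1 List.mem_cons_self

/-! ### Induced statement graphs -/

/-- The subgraph induced by `H` is a non-trivial statement graph with source `s` and sink `t`. -/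
def IsStatement (G : FlowGraph.{u}) (H : Set G.V) (s t : G.V) : Prop :=
  ∃ K : StatementGraph, K ≠ StatementGraph.trivial ∧ ∃ e : K.Vertex ≃ H,
    (∀ a b, K.graph.Adj a b ↔ G.graph.Adj (e a) (e b)) ∧
      (e K.source : G.V) = s ∧ (e K.sink : G.V) = t

/-- The properties of the non-trivial statement graphs on which confluence depends. -/
structure HasShape {V : Type*} (r : V → V → Prop) (H : Set V) (s t : V) : Prop where
  source_mem : s ∈ H
  sink_mem : t ∈ H
  ne : s ≠ t
  irrefl : ∀ x ∈ H, ¬ r x x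
  sink_not : ∀ x ∈ H, ¬ r t x
  inner : ∀ x ∈ H, x ≠ s → x ≠ t → r s x
  -- The second predecessor y of t is what distinguishes a branch from a chain s → x → t, which
  -- would not be prime.
  out : ∀ x ∈ H, x ≠ s → x ≠ t → r x s ∨ r x t ∧ ∃ y ∈ H, y ≠ x ∧ r y t ∧ (y = s ∨ r s y)
  reach : r s t ∨ ∃ w ∈ H, w ≠ s ∧ w ≠ t ∧ r s w ∧ r w t

/-- The fields are packed into one decidable proposition, so that `decide` settles each fixed-size
statement graph. -/
theorem HasShape.of_fin (n : ℕ) (r : ℕ → ℕ → Prop)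
    (h : 0 ≠ Fin.last n ∧ (∀ x : Fin (n + 1), ¬ r x x) ∧ (∀ x : Fin (n + 1), ¬ r n x) ∧
      (∀ x : Fin (n + 1), x ≠ 0 → x ≠ Fin.last n → r 0 x ∧
        (r x 0 ∨ r x n ∧ ∃ y : Fin (n + 1), y ≠ x ∧ r y n ∧ (y = 0 ∨ r 0 y))) ∧
      (r 0 n ∨ ∃ w : Fin (n + 1), w ≠ 0 ∧ w ≠ Fin.last n ∧ r 0 w ∧ r w n)) :
    HasShape (fun a b : Fin (n + 1) => r a b) Set.univ 0 (Fin.last n) where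
  source_mem := trivial
  sink_mem := trivial
  ne := h.1
  irrefl x _ := h.2.1 x
  sink_not x _ := h.2.2.1 x
  inner x _ hs ht := (h.2.2.2.1 x hs ht).1
  out x _ hs ht := by simpa using (h.2.2.2.1 x hs ht).2
  reach := by simpa using h.2.2.2.2

end FlowGraph

set_option synthInstance.maxSize 2000 in
set_option synthInstance.maxHeartbeats 200000 in
theorem StatementGraph.hasShape {K : StatementGraph} (hK : K ≠ .trivial) :
    FlowGraph.HasShape K.graph.Adj Set.univ K.source K.sink := by
  cases K with
  | trivial => exact absurd rfl hK
  | pCase p hp =>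
    have hlt : ∀ x : (pCase p hp).Vertex, (x : ℕ) < p + 2 := fun x => x.2
    have h2 : (2 : ℕ) < (pCase p hp).last + 1 := by simp only [last]; omega
    have h1 : (1 : ℕ) < (pCase p hp).last + 1 := by simp only [last]; omega
    have hs : ((pCase p hp).source : ℕ) = 0 := rfl
    have ht : ((pCase p hp).sink : ℕ) = p + 1 := rfl
    constructor
    · exact True.intro
    · exact True.intro
    · rw [Ne, Fin.ext_iff]; omega
    · intro x _; simp only [graph, Edge]; omega
    · intro x _; have := hlt x; simp only [graph, Edge]; omega
    · intro x _; have := hlt x; simp only [graph, Edge, Ne, Fin.ext_iff]; omega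
    · intro x _; have := hlt x
      simp only [graph, Edge, Ne, Fin.ext_iff]
      intro hxs hxt
      refine Or.inr ⟨by omega, ?_⟩
      -- Another branch is needed as y: branch 1, or branch 2 if x is branch 1.
      by_cases hx : (x : ℕ) = 1
      · exact ⟨⟨2, h2⟩, True.intro, by simp only; omega, by simp only; omega, by simp only; omega⟩
      · exact ⟨⟨1, h1⟩, True.intro, by simp only; omega, by simp only; omega, by simp only; omega⟩
    · refine Or.inr ⟨⟨1, h1⟩, True.intro, ?_⟩
      simp only [graph, Edge, Ne, Fin.ext_iff]
      omega
  | sequence => exact .of_fin 1 (fun a b => a = 0 ∧ b = 1) (by decide)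
  | ifThen =>
    exact .of_fin 2 (fun a b => (a = 0 ∧ b = 1) ∨ (a = 0 ∧ b = 2) ∨ (a = 1 ∧ b = 2)) (by decide)
  | ifThenElse =>
    exact .of_fin 3 (fun a b =>
      (a = 0 ∧ b = 1) ∨ (a = 0 ∧ b = 2) ∨ (a = 1 ∧ b = 3) ∨ (a = 2 ∧ b = 3)) (by decide)
  | whileLoop =>
    exact .of_fin 2 (fun a b => (a = 0 ∧ b = 1) ∨ (a = 1 ∧ b = 0) ∨ (a = 0 ∧ b = 2)) (by decide)
  | repeatLoop =>
    exact .of_fin 2 (fun a b => (a = 0 ∧ b = 1) ∨ (a = 1 ∧ b = 0) ∨ (a = 1 ∧ b = 2)) (by decide)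

namespace FlowGraph

variable {G G' : FlowGraph.{u}} {H K : Set G.V} {s t s' t' : G.V} {q : G.V → G'.V}

theorem IsStatement.hasShape (h : G.IsStatement H s t) : HasShape G.graph.Adj H s t := by
  obtain ⟨S, hS, e, he, rfl, rfl⟩ := h
  obtain ⟨-, -, hne, hirr, hsink, hinner, hout, hreach⟩ := StatementGraph.hasShape hS
  have hex : ∀ x ∈ H, ∃ a, (e a : G.V) = x := fun x hx => ⟨e.symm ⟨x, hx⟩, by simp⟩
  have hinj : ∀ a b, (e a : G.V) = e b ↔ a = b := fun a b => by
    rw [← Subtype.ext_iff, e.apply_eq_iff_eq]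
  constructor
  · exact (e _).2
  · exact (e _).2
  · rwa [Ne, hinj]
  · intro x hx
    obtain ⟨a, rfl⟩ := hex x hx
    rw [← he]
    exact hirr a trivial
  · intro x hx
    obtain ⟨a, rfl⟩ := hex x hx
    rw [← he]
    exact hsink a trivial
  · intro x hx
    obtain ⟨a, rfl⟩ := hex x hx
    rw [← he, Ne, Ne, hinj, hinj]
    exact hinner a trivial
  · intro x hx
    obtain ⟨a, rfl⟩ := hex x hx
    rw [← he, ← he, Ne, Ne, hinj, hinj]
    intro h1 h2
    refine (hout a trivial h1 h2).imp_right fun ⟨h3, b, _, hb, hbt, hsb⟩ =>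
      ⟨h3, e b, (e b).2, ?_⟩
    rw [← he, ← he, Ne, hinj, hinj]
    exact ⟨hb, hbt, hsb⟩
  · rw [← he]
    refine hreach.imp_right fun ⟨w, _, hw⟩ => ⟨e w, (e w).2, ?_⟩
    rwa [← he, ← he, Ne, Ne, hinj, hinj]

theorem IsStatement.image (h : G.IsStatement H s t) (hinj : Set.InjOn q H)
    (hadj : ∀ a ∈ H, ∀ b ∈ H, G.graph.Adj a b ↔ G'.graph.Adj (q a) (q b)) :
    G'.IsStatement (q '' H) (q s) (q t) := by
  obtain ⟨S, hS, e, he, rfl, rfl⟩ := h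
  refine ⟨S, hS, e.trans (Set.BijOn.equiv q hinj.bijOn_image), fun a b => ?_, rfl, rfl⟩
  rw [he, hadj _ (e a).2 _ (e b).2]
  rfl

/-! ### Isomorphisms -/

theorem Isomorphic.refl (G : FlowGraph.{u}) : G.Isomorphic G :=
  ⟨Equiv.refl _, fun _ _ => Iff.rfl, rfl⟩

theorem Isomorphic.symm (h : G.Isomorphic G') : G'.Isomorphic G := by
  obtain ⟨f, hf, hs⟩ := h
  exact ⟨f.symm, fun v w => by simp [hf], by simp [← hs]⟩

theorem Isomorphic.trans {G₁ G₂ G₃ : FlowGraph.{u}} (h : G₁.Isomorphic G₂)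
    (h' : G₂.Isomorphic G₃) : G₁.Isomorphic G₃ := by
  obtain ⟨f, hf, hs⟩ := h
  obtain ⟨g, hg, hs'⟩ := h'
  exact ⟨f.trans g, fun v w => by simp [hf, hg], by simp [hs, hs']⟩

theorem SimplePath.map (f : G.V ≃ G'.V) (hf : ∀ v w, G.graph.Adj v w ↔ G'.graph.Adj (f v) (f w))
    (hs : f G.source = G'.source) {l : List G.V} (h : G.SimplePath l) :
    G'.SimplePath (l.map f) := by
  induction h with
  | start => simpa [hs] using SimplePath.start (G := G')
  | push _ hvw hw ih => exact ih.push ((hf _ _).1 hvw) (by simpa using hw)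

theorem IsCycleEdge.map (f : G.V ≃ G'.V)
    (hf : ∀ v w, G.graph.Adj v w ↔ G'.graph.Adj (f v) (f w)) (hs : f G.source = G'.source)
    {v w : G.V} (h : G.IsCycleEdge v w) : G'.IsCycleEdge (f v) (f w) := by
  rw [isCycleEdge_iff] at h ⊢
  obtain ⟨h, l, hl, hw⟩ := h
  exact ⟨(hf _ _).1 h, l.map f, hl.map f hf hs, List.mem_map_of_mem hw⟩

theorem IsPrime.map (f : G.V ≃ G'.V)
    (hf : ∀ v w, G.graph.Adj v w ↔ G'.graph.Adj (f v) (f w)) (hs : f G.source = G'.source)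
    (h : G.IsPrime H s t) : G'.IsPrime (f '' H) (f s) (f t) := by
  obtain ⟨hstat, h1, h2, h3, h4⟩ := h
  refine ⟨IsStatement.image hstat f.injective.injOn fun a _ b _ => hf a b, ?_, ?_, ?_, ?_⟩
  · rintro _ ⟨v, hv, rfl⟩ hne u hu
    obtain ⟨u, rfl⟩ := f.surjective u
    exact ⟨u, h1 v hv (fun h => hne (h ▸ rfl)) u ((hf _ _).2 hu), rfl⟩
  · rintro _ ⟨v, hv, rfl⟩ hne u hu
    obtain ⟨u, rfl⟩ := f.surjective u
    exact ⟨u, h2 v hv (fun h => hne (h ▸ rfl)) u ((hf _ _).2 hu), rfl⟩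
  · intro v hv
    obtain ⟨v, rfl⟩ := f.surjective v
    have := hv.map f.symm (fun a b => by simp [hf]) (by simp [← hs])
    exact (hf _ _).1 (h3 v (by simpa using this))
  · rw [← hs]
    rintro ⟨v, hv, hvs⟩
    rw [f.injective hvs] at hv
    rw [h4 hv]

/-! ### Contractions as quotient maps -/

/-- `q` identifies the vertices of `H`, and `G'` has no other edges than the images of edges
of `G` that are not loops. -/
structure IsContraction (H : Set G.V) (q : G.V → G'.V) : Prop where
  surjective : Function.Surjective q
  eq_iff : ∀ a b, q a = q b ↔ a = b ∨ a ∈ H ∧ b ∈ H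
  adj_iff : ∀ x y, G'.graph.Adj x y ↔ x ≠ y ∧ ∃ a b, q a = x ∧ q b = y ∧ G.graph.Adj a b
  source : q G.source = G'.source

theorem isContraction_image (hs : s ∈ H) :
    IsContraction (G' := G.contract H s) H (G.image H s) where
  surjective := G.image_surjective H s
  eq_iff a b := by
    have hval : ∀ v, ((G.image H s v : {v : G.V // v = s ∨ v ∉ H}) : G.V) = s ∧ v ∈ H ∨
        ((G.image H s v : {v : G.V // v = s ∨ v ∉ H}) : G.V) = v ∧ v ∉ H := fun v => by
      unfold image
      split_ifs with hv <;> simp [hv]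
    refine (Subtype.ext_iff (a1 := G.image H s a) (a2 := G.image H s b)).trans ?_
    grind
  adj_iff _ _ := Iff.rfl
  source := rfl

theorem IsContraction.exists_of_isomorphic {G₁ G₂ : FlowGraph.{u}} {q : G.V → G₁.V}
    (h : IsContraction H q) (hiso : G₁.Isomorphic G₂) :
    ∃ q' : G.V → G₂.V, IsContraction H q' := by
  obtain ⟨f, hf, hs⟩ := hiso
  refine ⟨f ∘ q, f.surjective.comp h.surjective, fun a b => ?_, fun x y => ?_, ?_⟩
  · simp [h.eq_iff]
  · obtain ⟨x, rfl⟩ := f.surjective x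
    obtain ⟨y, rfl⟩ := f.surjective y
    simp [← hf, h.adj_iff]
  · simp [h.source, hs]

/-- The set H fixes the fibres of a contraction, and these fix the edges and source of the quotient.
-/
theorem IsContraction.isomorphic {G₁ G₂ : FlowGraph.{u}} {q₁ : G.V → G₁.V} {q₂ : G.V → G₂.V}
    (h₁ : IsContraction H q₁) (h₂ : IsContraction H q₂) : G₁.Isomorphic G₂ := by
  let r : G₁.V → G₂.V := fun x => q₂ (Function.surjInv h₁.surjective x)
  have hr : ∀ a, r (q₁ a) = q₂ a := fun a => by
    rw [h₂.eq_iff, ← h₁.eq_iff]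
    exact Function.surjInv_eq h₁.surjective _
  have hinj : Function.Injective r := by
    intro x y hxy
    obtain ⟨a, rfl⟩ := h₁.surjective x
    obtain ⟨b, rfl⟩ := h₁.surjective y
    rwa [hr, hr, h₂.eq_iff, ← h₁.eq_iff] at hxy
  have hsurj : Function.Surjective r := fun y => by
    obtain ⟨a, rfl⟩ := h₂.surjective y
    exact ⟨q₁ a, hr a⟩
  have hq : ∀ a x, q₂ a = r x ↔ q₁ a = x := fun a x => by rw [← hr, hinj.eq_iff]
  have hbij : Function.Bijective r := ⟨hinj, hsurj⟩
  refine ⟨Equiv.ofBijective r hbij, fun v w => ?_, ?_⟩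
  · simp only [Equiv.ofBijective_apply, h₁.adj_iff, h₂.adj_iff, hq, hinj.ne_iff]
  · rw [Equiv.ofBijective_apply, ← h₁.source, hr, h₂.source]

theorem IsContraction.eq_of_notMem (hq : IsContraction H q) {a b : G.V} (h : q a = q b)
    (ha : a ∉ H) : a = b :=
  ((hq.eq_iff a b).1 h).resolve_right fun h => ha h.1

theorem IsContraction.eq_of_mem (hq : IsContraction H q) {a b : G.V} (ha : a ∈ H) (hb : b ∈ H) :
    q a = q b :=
  (hq.eq_iff a b).2 (Or.inr ⟨ha, hb⟩)

/-- A simple path that enters `H` at `s` can be extended to `t`. -/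
theorem SimplePath.extend (hH : HasShape G.graph.Adj H s t) {l : List G.V}
    (h : G.SimplePath (s :: l)) (hl : ∀ u ∈ l, u ∉ H) :
    ∃ l', G.SimplePath (t :: l') ∧ (∀ u ∈ t :: l', u ∈ H ∨ u ∈ l) ∧ ∀ u ∈ s :: l, u ∈ t :: l' := by
  have htl : t ∉ l := fun h => hl t h hH.sink_mem
  rcases hH.reach with hst | ⟨w, hw, hws, hwt, hsw, hwt'⟩
  · refine ⟨s :: l, h.push hst (by simp [htl, hH.ne.symm]), ?_, fun u hu => by simp_all⟩
    simp only [List.mem_cons]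
    rintro u (rfl | rfl | hu)
    · exact Or.inl hH.sink_mem
    · exact Or.inl hH.source_mem
    · exact Or.inr hu
  · have hwl : w ∉ l := fun h => hl w h hw
    refine ⟨w :: s :: l, (h.push hsw (by simp [hws, hwl])).push hwt'
      (by simp [htl, hH.ne.symm, hwt.symm]), ?_, fun u hu => by simp_all⟩
    simp only [List.mem_cons]
    rintro u (rfl | rfl | rfl | hu)
    · exact Or.inl hH.sink_mem
    · exact Or.inl hw
    · exact Or.inl hH.source_mem
    · exact Or.inr hu

/-- Simple paths lift along contractions. -/
theorem IsContraction.lift (hq : IsContraction H q) (hH : HasShape G.graph.Adj H s t)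
    (hc : G.IsClosed H s t) {l' : List G'.V} (h : G'.SimplePath l') :
    -- The lift always stops at t when it ends in H, since H can be left only there. It may skip
    -- inner vertices of H, so only s and the vertices outside H are guaranteed to be on it.
    ∃ v l, G.SimplePath (v :: l) ∧ (v ∈ H → v = t) ∧ l'.head? = some (q v) ∧
      (∀ u ∈ v :: l, q u ∈ l') ∧ ∀ u, u ∉ H ∨ u = s → q u ∈ l' → u ∈ v :: l := by
  induction h with
  | start =>
    rw [← hq.source]
    by_cases hs : G.source ∈ H
    · have hs' := hc.2.2.2 hs
      obtain ⟨l, hl, hl1, hl2⟩ := SimplePath.extend (G := G) (l := []) hH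
        (hs' ▸ SimplePath.start) (by simp)
      refine ⟨t, l, hl, fun _ => rfl, ?_, ?_, ?_⟩
      · simp [hq.eq_of_mem hs hH.sink_mem]
      · intro u hu
        rcases hl1 u hu with hu | hu
        · simp [hq.eq_of_mem hu hs]
        · simp at hu
      · rintro u (hu | rfl) h
        · exact absurd hs (hq.eq_of_notMem (List.mem_singleton.1 h) hu ▸ hu)
        · exact hl2 u (by simp)
    · refine ⟨_, [], .start, fun h => absurd h hs, rfl, by simp, fun u _ h => ?_⟩
      rw [← hq.eq_of_notMem (List.mem_singleton.1 h).symm hs]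
      simp
  | @push x y l' _ hxy hy ih =>
    obtain ⟨v, l, hl, hvt, hhead, h1, h2⟩ := ih
    simp only [List.head?_cons, Option.some.injEq] at hhead
    subst hhead
    obtain ⟨hne, a, b, ha, rfl, hab⟩ := (hq.adj_iff _ _).1 hxy
    have hav : a = v := by
      rcases (hq.eq_iff _ _).1 ha with h | ⟨haH, hvH⟩
      · exact h
      · rw [hvt hvH]
        by_contra hat
        exact hne (hq.eq_of_mem hvH (hc.2.1 a haH hat b hab))
    subst hav
    have hb : b ∉ a :: l := fun h => hy (h1 b h)
    by_cases hbH : b ∈ H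
    · have hbs : b = s := by
        by_contra hbs
        exact hne (hq.eq_of_mem (hc.1 b hbH hbs a hab) hbH)
      subst hbs
      -- The class of H is new on the path below, so the lift has not met H yet.
      have hdisj : ∀ u ∈ a :: l, u ∉ H := fun u hu huH => hy (hq.eq_of_mem hbH huH ▸ h1 u hu)
      obtain ⟨l₂, hl₂, h3, h4⟩ := (hl.push hab hb).extend hH hdisj
      refine ⟨t, l₂, hl₂, fun _ => rfl, ?_, ?_, ?_⟩
      · simp [hq.eq_of_mem hbH hH.sink_mem]
      · intro u hu
        rcases h3 u hu with hu | hu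
        · simp [hq.eq_of_mem hu hbH]
        · exact List.mem_cons_of_mem _ (h1 u hu)
      · intro u hu hmem
        refine h4 u ?_
        rcases List.mem_cons.1 hmem with h | h
        · rcases hu with hu | rfl
          · rw [hq.eq_of_notMem h hu]
            exact List.mem_cons_self
          · exact List.mem_cons_self
        · exact List.mem_cons_of_mem _ (h2 u hu h)
    · refine ⟨b, a :: l, hl.push hab hb, fun h => absurd h hbH, rfl, ?_, ?_⟩
      · intro u hu
        rcases List.mem_cons.1 hu with rfl | hu
        · exact List.mem_cons_self
        · exact List.mem_cons_of_mem _ (h1 u hu)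
      · intro u hu hmem
        rcases List.mem_cons.1 hmem with h | h
        · rw [hq.eq_of_notMem h.symm hbH]
          exact List.mem_cons_self
        · exact List.mem_cons_of_mem _ (h2 u hu h)

/-- Cycle edges of a contracted graph come from cycle edges. -/
theorem IsContraction.lift_isCycleEdge (hq : IsContraction H q)
    (hH : HasShape G.graph.Adj H s t) (hc : G.IsClosed H s t) {x : G'.V} {w : G.V}
    (hw : w ∉ H ∨ w = s) (h : G'.IsCycleEdge x (q w)) : ∃ v, q v = x ∧ G.IsCycleEdge v w := by
  obtain ⟨hadj, l', hl', hmem⟩ := isCycleEdge_iff.1 h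
  obtain ⟨v, l, hl, hvt, hhead, -, h2⟩ := hq.lift hH hc hl'
  simp only [List.head?_cons, Option.some.injEq] at hhead
  subst hhead
  obtain ⟨hne, a, b, ha, hb, hab⟩ := (hq.adj_iff _ _).1 hadj
  have hwl : w ∈ l := by
    rcases List.mem_cons.1 (h2 w hw (List.mem_cons_of_mem _ hmem)) with rfl | h
    · exact absurd rfl hne
    · exact h
  have hbw : b = w := by
    rcases (hq.eq_iff _ _).1 hb with h | ⟨hbH, hwH⟩
    · exact h
    · rcases hw with hw | rfl
      · exact absurd hwH hw
      · by_contra hbs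
        exact hne (ha ▸ hq.eq_of_mem (hc.1 b hbH hbs a hab) hwH)
  subst hbw
  have hav : a = v := by
    rcases (hq.eq_iff _ _).1 ha with h | ⟨haH, hvH⟩
    · exact h
    · rw [hvt hvH]
      by_contra hat
      exact hne (hq.eq_of_mem hvH (hc.2.1 a haH hat b hab))
  subst hav
  exact ⟨a, rfl, isCycleEdge_iff.2 ⟨hab, l, hl, hwl⟩⟩

/-! ### Two primes -/

theorem IsPrime.hasShape (h : G.IsPrime H s t) : HasShape G.graph.Adj H s t :=
  IsStatement.hasShape h.1

/-- Inner vertices are successors of s, and closedness keeps all successors of s in H; so source and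
sink determine a prime. -/
theorem IsPrime.eq_or_adj (h : G.IsPrime H s t) {x : G.V} :
    x ∈ H ↔ x = s ∨ x = t ∨ G.graph.Adj s x := by
  have hH := h.hasShape
  constructor
  · intro hx
    have := hH.inner x hx
    tauto
  · rintro (rfl | rfl | hx)
    · exact hH.source_mem
    · exact hH.sink_mem
    · exact h.2.2.1 s hH.source_mem hH.ne x hx

/-- Otherwise t' is an inner vertex of H. It cannot return to s inside K, so it goes to t, and the
other predecessor y of t lies in K and pulls t into K. Then the sink t' has an edge inside K. -/
theorem IsPrime.not_adj_sink_of_ne (h₁ : G.IsPrime H s t) (h₂ : G.IsPrime K s t') (hne : t ≠ t') :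
    ¬ G.graph.Adj s t' := by
  intro hst'
  have hH := h₁.hasShape
  have hK := h₂.hasShape
  have ht'H := h₁.2.2.1 s hH.source_mem hH.ne t' hst'
  rcases hH.out t' ht'H hK.ne.symm hne.symm with h | ⟨h, y, hy, hyt', hyt, hys⟩
  · exact hK.sink_not s hK.source_mem h
  · refine hK.sink_not t ?_ h
    rcases hys with rfl | hys
    · exact h₂.2.2.1 y hK.source_mem hK.ne t hyt
    · exact h₂.2.2.1 y (h₂.eq_or_adj.2 (Or.inr (Or.inr hys))) hyt' t hyt

theorem IsPrime.sink_unique (h₁ : G.IsPrime H s t) (h₂ : G.IsPrime K s t') : t = t' := by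
  by_contra hne
  have hH := h₁.hasShape
  have hst := h₂.not_adj_sink_of_ne h₁ (Ne.symm hne)
  have hst' := h₁.not_adj_sink_of_ne h₂ hne
  rcases hH.reach with h | ⟨w, hw, hws, hwt, hsw, hwt'⟩
  · exact hst h
  · have hwK := h₂.eq_or_adj.2 (Or.inr (Or.inr hsw))
    have htK := h₂.2.2.1 w hwK (fun h => hst' (h ▸ hsw)) t hwt'
    rcases h₂.eq_or_adj.1 htK with h | h | h
    · exact hH.ne h.symm
    · exact hne h
    · exact hst h

theorem IsPrime.eq_of_source_eq (h₁ : G.IsPrime H s t) (h₂ : G.IsPrime K s t') : H = K := by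
  have := h₁.sink_unique h₂
  subst this
  ext x
  rw [h₁.eq_or_adj, h₂.eq_or_adj]

/-- The primes `H` and `K` are consecutive: the sink of `H` is the source of `K`, and there is no
other common vertex. -/
def Consecutive (H K : Set G.V) (t s' : G.V) : Prop :=
  t = s' ∧ ∀ x ∈ H, x ∈ K → x = t

/-- By domination s ∉ K. Were s' an inner vertex of H, an edge back to s would put s in K; otherwise
t ∈ K, and going backwards from t through y, which avoids s', again leads to s. -/
theorem IsPrime.consecutive (h₁ : G.IsPrime H s t) (h₂ : G.IsPrime K s' t') (hne : s ≠ s')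
    (hmem : s' ∈ H) : Consecutive H K t s' := by
  have hH := h₁.hasShape
  have hK := h₂.hasShape
  have hsK : s ∉ K := fun h => hne (h₁.2.source_eq_of_mem h₂.2 h hmem)
  have hout : ∀ x, G.graph.Adj s' x → x ∈ K := h₂.2.2.1 s' hK.source_mem hK.ne
  have hinner : ∀ x ∈ H, x ∈ K → x ≠ s' → x = t := by
    intro x hx hxK hxs'
    by_contra hxt
    exact hsK (h₂.2.1 x hxK hxs' s (hH.inner x hx (fun h => hsK (h ▸ hxK)) hxt))
  have hts : t = s' := by
    by_contra hts
    rcases hH.out s' hmem (Ne.symm hne) (Ne.symm hts) with h | ⟨h, y, hy, hys', hyt, hys⟩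
    · exact hsK (hout s h)
    · have hyK := h₂.2.1 t (hout t h) hts y hyt
      rcases hys with rfl | hys
      · exact hsK hyK
      · exact hsK (h₂.2.1 y hyK hys' s hys)
  refine ⟨hts, fun x hx hxK => ?_⟩
  by_cases hxs' : x = s'
  · rw [hxs', hts]
  · exact hinner x hx hxK hxs'

/-- When neither source lies in the other prime, a common vertex drags its predecessors into K, back
along a path of at most two edges inside H, until s is in K. -/
theorem IsPrime.disjoint_or (h₁ : G.IsPrime H s t) (h₂ : G.IsPrime K s' t') (hne : s ≠ s') :
    Disjoint H K ∨ Consecutive H K t s' ∨ Consecutive K H t' s := by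
  by_cases hs' : s' ∈ H
  · exact Or.inr (Or.inl (h₁.consecutive h₂ hne hs'))
  by_cases hs : s ∈ K
  · exact Or.inr (Or.inr (h₂.consecutive h₁ hne.symm hs))
  refine Or.inl (Set.disjoint_left.2 fun x hx hxK => ?_)
  have hH := h₁.hasShape
  have key : ∀ x ∈ H, G.graph.Adj s x → x ∉ K := fun x hx h hxK =>
    hs (h₂.2.1 x hxK (fun h => hs' (h ▸ hx)) s h)
  by_cases hxt : x = t
  · subst hxt
    rcases hH.reach with h | ⟨w, hw, -, -, hsw, hwt⟩
    · exact key x hx h hxK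
    · exact key w hw hsw (h₂.2.1 x hxK (fun h => hs' (h ▸ hx)) w hwt)
  · exact key x hx (hH.inner x hx (fun h => hs (h ▸ hxK)) hxt) hxK

/-- As s dominates t = s', which dominates a, such an edge would be a cycle edge. The cycle-edge
clause then gives an edge from s to a, so a ∈ H ∩ K is t, a sink with no edge into H. -/
theorem Consecutive.not_adj (h₁ : G.IsPrime H s t) (h₂ : G.IsPrime K s' t')
    (hcons : Consecutive H K t s') : ∀ a ∈ K, ¬ G.graph.Adj a s := by
  intro a ha has
  obtain ⟨rfl, hint⟩ := hcons
  have hH := h₁.hasShape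
  have hsK : s ∉ K := fun h => hH.ne (hint s hH.source_mem h)
  obtain ⟨l, hl⟩ := G.exists_simplePath a
  have hmem := hl.source_mem h₁.2 (hl.source_mem h₂.2 List.mem_cons_self ha) hH.sink_mem
  have hsl : s ∈ l := (List.mem_cons.1 hmem).resolve_left fun h => hsK (h ▸ ha)
  have hsa := h₁.2.2.2.1 a (isCycleEdge_iff.2 ⟨has, l, hl, hsl⟩)
  have := hint a (h₁.2.2.1 s hH.source_mem hH.ne a hsa) ha
  subst this
  exact hH.sink_not s hH.source_mem has

/-- A prime remains prime when another one is contracted. -/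
theorem IsPrime.image_of_ne (h₁ : G.IsPrime H s t) (h₂ : G.IsPrime K s' t') (hne : s ≠ s')
    (hq : IsContraction H q) : G'.IsPrime (q '' K) (q s') (q t') := by
  have hH := h₁.hasShape
  have hK := h₂.hasShape
  have hcases := h₁.disjoint_or h₂ hne
  have hcommon : ∀ x ∈ K, x ∈ H → (x = s' ∧ s' = t) ∨ (x = t' ∧ t' = s) := by
    intro x hxK hxH
    rcases hcases with h | ⟨h, h'⟩ | ⟨h, h'⟩
    · exact absurd hxK (Set.disjoint_left.1 h hxH)
    · exact Or.inl ⟨(h' x hxH hxK).trans h, h.symm⟩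
    · exact Or.inr ⟨h' x hxK hxH, h⟩
  have hsub : ∀ x ∈ K, ∀ y ∈ K, x ∈ H → y ∈ H → x = y := by
    intro x hxK y hyK hx hy
    rcases hcases with h | ⟨h, h'⟩ | ⟨h, h'⟩
    · exact absurd hxK (Set.disjoint_left.1 h hx)
    · rw [h' x hx hxK, h' y hy hyK]
    · rw [h' x hxK hx, h' y hyK hy]
  have hinj : Set.InjOn q K := by
    intro a ha b hb hab
    rcases (hq.eq_iff a b).1 hab with h | ⟨h, h'⟩
    · exact h
    · exact hsub a ha b hb h h'
  have hback : s' = t → ∀ a ∈ K, ¬ G.graph.Adj a s := fun h =>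
    Consecutive.not_adj h₁ h₂
      ⟨h.symm, fun x hx hxK => hsub x hxK t (h ▸ hK.source_mem) hx hH.sink_mem⟩
  have hback' : t' = s → ∀ a ∈ H, ¬ G.graph.Adj a s' := fun h =>
    Consecutive.not_adj h₂ h₁
      ⟨h, fun x hx hxH => hsub x hx t' hK.sink_mem hxH (h ▸ hH.source_mem)⟩
  refine ⟨IsStatement.image h₂.1 hinj fun a ha b hb => ⟨fun hab => ?_, fun hab => ?_⟩,
    ?_, ?_, ?_, ?_⟩
  · refine (hq.adj_iff _ _).2 ⟨fun h => ?_, a, b, rfl, rfl, hab⟩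
    rw [hinj ha hb h] at hab
    exact hK.irrefl b hb hab
  · obtain ⟨hqne, a', b', ha', hb', hab'⟩ := (hq.adj_iff _ _).1 hab
    -- The edge in the quotient may come from other representatives in H. Closedness then forces it
    -- to leave H at t or enter H at s.
    rcases (hq.eq_iff _ _).1 ha' with rfl | ⟨ha'H, haH⟩ <;>
      rcases (hq.eq_iff _ _).1 hb' with rfl | ⟨hb'H, hbH⟩
    · exact hab'
    · have hb's : b' = s := by
        by_contra h
        exact hqne (hq.eq_of_mem (h₁.2.1 b' hb'H h a' hab') hbH)
      subst hb's
      rcases hcommon b hb hbH with ⟨-, h⟩ | ⟨h, h'⟩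
      · exact absurd hab' (hback h a' ha)
      · rwa [h, h']
    · have ha't : a' = t := by
        by_contra h
        exact hqne (hq.eq_of_mem haH (h₁.2.2.1 a' ha'H h b' hab'))
      subst ha't
      rcases hcommon a ha haH with ⟨h, h'⟩ | ⟨h, h'⟩
      · rwa [h, h']
      · exfalso
        by_cases hbs : b' = s'
        · exact hback' h' a' ha'H (hbs ▸ hab')
        · exact hH.ne (hsub s (h' ▸ hK.sink_mem) a' (h₂.2.1 b' hb hbs a' hab') hH.source_mem ha'H)
    · exact absurd (hq.eq_of_mem haH hbH) hqne
  · rintro _ ⟨b, hb, rfl⟩ hbs x hx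
    obtain ⟨hqne, a', b', rfl, hb', hab'⟩ := (hq.adj_iff _ _).1 hx
    rcases (hq.eq_iff _ _).1 hb' with rfl | ⟨hb'H, hbH⟩
    · exact ⟨a', h₂.2.1 b' hb (fun h => hbs (h ▸ rfl)) a' hab', rfl⟩
    · rcases hcommon b hb hbH with ⟨h, -⟩ | ⟨h, h'⟩
      · exact absurd (h ▸ rfl) hbs
      · by_cases hb's : b' = s
        · refine ⟨a', h₂.2.1 b' ?_ ?_ a' hab', rfl⟩
          · rw [hb's, ← h']
            exact hK.sink_mem
          · rw [hb's]
            exact hne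
        · exact absurd (hq.eq_of_mem (h₁.2.1 b' hb'H hb's a' hab') hbH) hqne
  · rintro _ ⟨a, ha, rfl⟩ hat x hx
    obtain ⟨hqne, a', b', ha', rfl, hab'⟩ := (hq.adj_iff _ _).1 hx
    rcases (hq.eq_iff _ _).1 ha' with rfl | ⟨ha'H, haH⟩
    · exact ⟨b', h₂.2.2.1 a' ha (fun h => hat (h ▸ rfl)) b' hab', rfl⟩
    · rcases hcommon a ha haH with ⟨h, h'⟩ | ⟨h, -⟩
      · by_cases ha't : a' = t
        · refine ⟨b', h₂.2.2.1 a' ?_ ?_ b' hab', rfl⟩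
          · rw [ha't, ← h']
            exact hK.source_mem
          · rw [ha't, ← h']
            exact hK.ne
        · exact absurd (hq.eq_of_mem haH (h₁.2.2.1 a' ha'H ha't b' hab')) hqne
      · exact absurd (h ▸ rfl) hat
  · intro x hx
    have hxne := ((hq.adj_iff _ _).1 hx.1).1
    -- If s' is merged with s, a cycle edge into it would lift to one into s, starting at a
    -- successor of s and hence in H; but then its image is a loop.
    by_cases hs'H : s' ∈ H
    · have hqs : q s' = q s := hq.eq_of_mem hs'H hH.source_mem
      rw [hqs] at hx hxne
      obtain ⟨v, rfl, hv⟩ := hq.lift_isCycleEdge hH h₁.2 (Or.inr rfl) hx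
      exact absurd (hq.eq_of_mem
        (h₁.2.2.1 s hH.source_mem hH.ne v (h₁.2.2.2.1 v hv)) hH.source_mem) hxne
    · obtain ⟨v, rfl, hv⟩ := hq.lift_isCycleEdge hH h₁.2 (Or.inl hs'H) hx
      exact (hq.adj_iff _ _).2 ⟨hxne.symm, s', v, rfl, rfl, h₂.2.2.2.1 v hv⟩
  · rw [← hq.source]
    rintro ⟨k, hk, hks⟩
    rcases (hq.eq_iff _ _).1 hks with rfl | ⟨hkH, hsH⟩
    · rw [h₂.2.2.2.2 hk]
    · rcases hcommon k hk hkH with ⟨h, -⟩ | ⟨h, h'⟩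
      · rw [← hks, h]
      · have hks' : k = G.source := h.trans (h'.trans (h₁.2.2.2.2 hsH).symm)
        rw [h₂.2.2.2.2 (hks' ▸ hk)]

/-! ### Confluence -/

/-- `G'` results from `G` by the contraction of a non-trivial prime. -/
def Step (G G' : FlowGraph.{u}) : Prop :=
  ∃ (H : Set G.V) (s t : G.V) (q : G.V → G'.V), G.IsPrime H s t ∧ IsContraction H q

theorem IsContraction.of_isomorphic {G₁ : FlowGraph.{u}} (f : G.V ≃ G₁.V)
    (hf : ∀ v w, G.graph.Adj v w ↔ G₁.graph.Adj (f v) (f w)) (hs : f G.source = G₁.source)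
    (hq : IsContraction H q) : IsContraction (f '' H) (q ∘ f.symm) where
  surjective := hq.surjective.comp f.symm.surjective
  eq_iff a b := by
    obtain ⟨a, rfl⟩ := f.surjective a
    obtain ⟨b, rfl⟩ := f.surjective b
    simp [hq.eq_iff]
  adj_iff x y := by
    rw [hq.adj_iff]
    refine and_congr_right fun _ => ⟨?_, ?_⟩
    · rintro ⟨a, b, ha, hb, hab⟩
      exact ⟨f a, f b, by simpa, by simpa, (hf _ _).1 hab⟩
    · rintro ⟨a, b, ha, hb, hab⟩
      exact ⟨f.symm a, f.symm b, ha, hb, (hf _ _).2 (by simpa)⟩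
  source := by simp [← hs, hq.source]

theorem Step.of_isomorphic {G₁ G₂ G₃ : FlowGraph.{u}} (h : G₁.Step G₃) (hiso : G₁.Isomorphic G₂) :
    G₂.Step G₃ := by
  obtain ⟨H, s, t, q, hp, hq⟩ := h
  obtain ⟨f, hf, hs⟩ := hiso
  exact ⟨f '' H, f s, f t, _, hp.map f hf hs, hq.of_isomorphic f hf hs⟩

/-- For distinct sources, both orders of contraction divide G by the equivalence relation generated
by merging H and merging K. -/
theorem Step.diamond {G₁ G₂ : FlowGraph.{u}} (h₁ : G.Step G₁) (h₂ : G.Step G₂) :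
    G₁.Isomorphic G₂ ∨ ∃ G₃, G₁.Step G₃ ∧ G₂.Step G₃ := by
  obtain ⟨H, s, t, q₁, hp₁, hq₁⟩ := h₁
  obtain ⟨K, s', t', q₂, hp₂, hq₂⟩ := h₂
  by_cases hne : s = s'
  · subst hne
    have := hp₁.eq_of_source_eq hp₂
    subst this
    exact Or.inl (hq₁.isomorphic hq₂)
  have hp₂' := hp₁.image_of_ne hp₂ hne hq₁
  have hp₁' := hp₂.image_of_ne hp₁ (Ne.symm hne) hq₂
  have hq := isContraction_image (G := G₁) hp₂'.hasShape.source_mem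
  set G₃ := G₁.contract (q₁ '' K) (q₁ s') with hG₃
  set i : G₁.V → G₃.V := G₁.image (q₁ '' K) (q₁ s') with hi
  -- If H and K meet, contracting one and then the image of the other collapses their whole union.
  have hmem₁ : ∀ a, q₁ a ∈ q₁ '' K ↔ a ∈ K ∨ a ∈ H ∧ ∃ x, x ∈ H ∧ x ∈ K := by
    intro a
    simp only [Set.mem_image, hq₁.eq_iff]
    grind
  have hmem₂ : ∀ a, q₂ a ∈ q₂ '' H ↔ a ∈ H ∨ a ∈ K ∧ ∃ x, x ∈ H ∧ x ∈ K := by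
    intro a
    simp only [Set.mem_image, hq₂.eq_iff]
    grind
  have hker : ∀ a b, i (q₁ a) = i (q₁ b) ↔
      q₂ a = q₂ b ∨ q₂ a ∈ q₂ '' H ∧ q₂ b ∈ q₂ '' H := by
    intro a b
    rw [hq.eq_iff, hmem₁, hmem₁, hmem₂, hmem₂, hq₁.eq_iff, hq₂.eq_iff]
    by_cases hx : ∃ x, x ∈ H ∧ x ∈ K
    · simp only [hx, and_true]
      tauto
    · simp only [hx, and_false, or_false]
      tauto
  let r : G₂.V → G₃.V := fun x => i (q₁ (Function.surjInv hq₂.surjective x))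
  have hr : ∀ a, r (q₂ a) = i (q₁ a) := fun a =>
    (hker _ _).2 (Or.inl (Function.surjInv_eq hq₂.surjective _))
  refine Or.inr ⟨G₃, ⟨_, _, _, i, hp₂', hq⟩, ⟨_, _, _, r, hp₁', ?_, ?_, ?_, ?_⟩⟩
  · intro z
    obtain ⟨y, rfl⟩ := hq.surjective z
    obtain ⟨a, rfl⟩ := hq₁.surjective y
    exact ⟨q₂ a, hr a⟩
  · intro x y
    obtain ⟨a, rfl⟩ := hq₂.surjective x
    obtain ⟨b, rfl⟩ := hq₂.surjective y
    rw [hr, hr, hker]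
  · intro x y
    rw [hq.adj_iff]
    refine and_congr_right fun hxy => ⟨?_, ?_⟩
    · rintro ⟨_, _, rfl, rfl, h⟩
      obtain ⟨-, a, b, rfl, rfl, hab⟩ := (hq₁.adj_iff _ _).1 h
      refine ⟨q₂ a, q₂ b, hr a, hr b, (hq₂.adj_iff _ _).2 ⟨fun h => hxy ?_, a, b, rfl, rfl, hab⟩⟩
      rw [← hr, ← hr, h]
    · rintro ⟨_, _, rfl, rfl, h⟩
      obtain ⟨-, a, b, rfl, rfl, hab⟩ := (hq₂.adj_iff _ _).1 h
      rw [hr, hr] at hxy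
      exact ⟨q₁ a, q₁ b, (hr a).symm, (hr b).symm,
        (hq₁.adj_iff _ _).2 ⟨fun h => hxy (congrArg i h), a, b, rfl, rfl, hab⟩⟩
  · rw [← hq₂.source, hr, hq₁.source, hq.source]

/-- `G'` results from `G`, up to isomorphism, by `k` contractions. -/
def Reduces : ℕ → FlowGraph.{u} → FlowGraph.{u} → Prop
  | 0, G, G' => G.Isomorphic G'
  | k + 1, G, G' => ∃ G₁, G.Step G₁ ∧ Reduces k G₁ G'

theorem Reduces.of_isomorphic {G₁ G₂ A : FlowGraph.{u}} {k : ℕ} (h : Reduces k G₁ A)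
    (hiso : G₁.Isomorphic G₂) : Reduces k G₂ A := by
  cases k with
  | zero => exact hiso.symm.trans h
  | succ k =>
    obtain ⟨G₃, h, h'⟩ := h
    exact ⟨G₃, h.of_isomorphic hiso, h'⟩

/-- The diamond carries the given step past the first step of the reduction without changing the
number of steps; irreducibility of the end excludes running out of steps. -/
theorem Reduces.descend {G G₁ A : FlowGraph.{u}} {k : ℕ} (h : Reduces k G A)
    (hA : ∀ B, ¬ A.Step B) (hstep : G.Step G₁) : ∃ j, k = j + 1 ∧ Reduces j G₁ A := by
  induction k generalizing G G₁ with
  | zero => exact absurd (hstep.of_isomorphic h) (hA _)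
  | succ k ih =>
    obtain ⟨G₂, h₂, h⟩ := h
    refine ⟨k, rfl, ?_⟩
    rcases h₂.diamond hstep with hiso | ⟨G₃, h₂₃, h₁₃⟩
    · exact h.of_isomorphic hiso
    · obtain ⟨j, rfl, hj⟩ := ih h h₂₃
      exact ⟨G₃, h₁₃, hj⟩

theorem Reduces.unique {G A B : FlowGraph.{u}} {k k' : ℕ} (h : Reduces k G A)
    (h' : Reduces k' G B) (hA : ∀ C, ¬ A.Step C) (hB : ∀ C, ¬ B.Step C) :
    A.Isomorphic B ∧ k = k' := by
  induction k' generalizing G k with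
  | zero =>
    cases k with
    | zero => exact ⟨Isomorphic.trans (Isomorphic.symm h) h', rfl⟩
    | succ k =>
      obtain ⟨G₁, h, -⟩ := h
      exact absurd (h.of_isomorphic h') (hB _)
  | succ k' ih =>
    obtain ⟨G₁, h₁, h'⟩ := h'
    obtain ⟨j, rfl, hj⟩ := h.descend hA h₁
    obtain ⟨hiso, rfl⟩ := ih hj h'
    exact ⟨hiso, rfl⟩

theorem IsContractileSequence.reduces {G : FlowGraph.{u}} {k : ℕ} {S : Fin (k + 1) → FlowGraph.{u}}
    (h : G.IsContractileSequence k S) : Reduces k G (S (Fin.last k)) := by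
  induction k generalizing G with
  | zero => exact h.1
  | succ k ih =>
    obtain ⟨h0, hS⟩ := h
    obtain ⟨H, s, t, hp, hiso⟩ := hS 0
    obtain ⟨q, hq⟩ := (isContraction_image hp.hasShape.source_mem).exists_of_isomorphic hiso.symm
    have hstep : (S 0).Step (S 1) := ⟨H, s, t, q, hp, hq⟩
    refine ⟨S 1, hstep.of_isomorphic h0.symm, ?_⟩
    exact ih (S := fun i => S i.succ) ⟨Isomorphic.refl _, fun i => hS i.succ⟩

end FlowGraph

theorem mainTheorem1 (G : FlowGraph.{u}) (k k' : ℕ)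
    (S : Fin (k + 1) → FlowGraph.{u}) (S' : Fin (k' + 1) → FlowGraph.{u})
    (hS : G.IsContractileSequence k S) (hS' : G.IsContractileSequence k' S')
    (hmax : FlowGraph.IsMaximalSequence k S) (hmax' : FlowGraph.IsMaximalSequence k' S') :
    (S (Fin.last k)).Isomorphic (S' (Fin.last k')) ∧ k = k' := by
  exact hS.reduces.unique hS'.reduces (fun _ ⟨H, s, t, _, hp, _⟩ => hmax ⟨H, s, t, hp⟩)
    fun _ ⟨H, s, t, _, hp, _⟩ => hmax' ⟨H, s, t, hp⟩
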